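/- Let $d\ge 1$, let $N$ and $\ell_1,\dots,\ell_{d+1}$ be nonnegative integers with $\ell_i\le N$ for all $i$ and $\ell_i+\ell_j\ge N$ for all $i\ne j$. Write $|\ell|=\ell_1+\cdots+\ell_{d+1}$, $\ell_{\min}=\min_i \ell_i$, $|x|=x_1+\cdots+x_d$ for a vector $x$ with $d$ entries, and $(a)_k=a(a+1)\cdots(a+k-1)$. Let $$V^d_{\ell,N}=\{x\in\mathbb N_0^d:\ x_i\le \ell_i\ (1\le i\le d),\ N-\ell_{d+1}\le |x|\le N\}.$$ For $\nu\in\mathbb N_0^d$ and $1\le j\le d$ put $\alpha_j=\alpha_j(\nu)=\sum_{i=j+1}^{d+1}\ell_i-2\sum_{i=j+1}^{d}\nu_i$ and $$H^d_{\ell,N}=\{\nu\in\mathbb N_0^d:\ |\nu|\le N,\ |\nu|\le|\ell|-N,\ \nu_j\le \ell_j,\ \nu_j\le\alpha_j\ (1\le j\le d)\}.$$ For $\nu\in H^d_{\ell,N}$ the Hahn polynomial for the hypergeometric distribution is $$Q_\nu(x;\ell,N)=\prod_{j=1}^d (-M_j)_{\nu_j}\;{}_3F_2\!\left(\begin{matrix}-\nu_j,\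 \nu_j-\ell_j-\alpha_j-1,\ -x_j\\ -\ell_j,\ -M_j\end{matrix};1\right),\qquad M_j=N-\sum_{i<j}x_i-\sum_{i>j}\nu_i ,$$ where ${}_3F_2$ is summed over $0\le k\le\nu_j$ and $(-M_j)_{\nu_j}/(-M_j)_k$ is read as the polynomial $(-M_j+k)_{\nu_j-k}$. Let $$B_\nu(\ell,N)=\frac{(-1)^{|\nu|}(-N)_{|\nu|}(-|\ell|)_{N+|\nu|}}{(-|\ell|)_N(-|\ell|)_{2|\nu|}}\prod_{j=1}^d\frac{(-\alpha_j)_{\nu_j}(-\ell_j-\alpha_j-1)_{2\nu_j}\,\nu_j!}{(-\ell_j)_{\nu_j}(-\ell_j-\alpha_j-1)_{\nu_j}},$$ and define the reproducing kernel of degree $n$ by $$P_n(H_{\ell,N};x,y)=\sum_{\nu\in H^d_{\ell,N},\ |\nu|=n}\frac{Q_\nu(x;\ell,N)\,Q_\nu(y;\ell,N)}{B_\nu(\ell,N)} .$$ For $x,y\in V^d_{\ell,N}$ let $X=(x,N-|x|)$, $Y=(y,N-|y|)$ and $$E_k(x,y;\ell)=\sum_{\substack{\gamma\in\mathbb N_0^{d+1},\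 |\gamma|=k\\ \gamma_i\le\ell_i}}\ \prod_{i=1}^{d+1}\frac{(-X_i)_{\gamma_i}(-Y_i)_{\gamma_i}}{(-\ell_i)_{\gamma_i}\,\gamma_i!}.$$ Then, for all $x,y\in V^d_{\ell,N}$ and all integers $0\le n\le\ell_{\min}$ (when $d=1$, assume also $n\le \ell_1+\ell_2-N$), $$P_n(H_{\ell,N};x,y)=\frac{(-N)_n\,(-|\ell|)_N\,(-|\ell|)_n\,(|\ell|+1-2n)}{n!\,(-|\ell|)_{N+n}\,(|\ell|+1-n)}\ \sum_{k=0}^n\frac{(-n)_k\,(n-1-|\ell|)_k}{(-N)_k\,(-N)_k}\,E_k(x,y;\ell).$$ -/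

import Mathlib

namespace HahnPolyhedra

open Finset

/-- The Pochhammer symbol `(a)_k = a (a + 1) ⋯ (a + k - 1)`. -/
noncomputable def poch (a : ℝ) (k : ℕ) : ℝ := (ascPochhammer ℝ k).eval a

/-- The one-variable Hahn polynomial with negative parameters,
`₃F₂(-n, n - a - b - 1, -x; -a, -M; 1)`, as a terminating series. -/
noncomputable def hahn (n : ℕ) (x a b M : ℝ) : ℝ :=
  ∑ k ∈ range (n + 1),
    poch (-n) k * poch (n - a - b - 1) k * poch (-x) k / (poch (-a) k * poch (-M) k * (k.factorial : ℝ))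

/-- The product `(-M)_n · ₃F₂(-n, n - a - b - 1, -x; -a, -M; 1)` as a polynomial in `x` and `M`:
the quotient `(-M)_n / (-M)_k`, `k ≤ n`, is the polynomial `(-M + k)_{n-k}`, so that the product has a
meaning also where `(-M)_n` vanishes (see `hahnCleared_eq`). -/
noncomputable def hahnCleared (n : ℕ) (x a b M : ℝ) : ℝ :=
  ∑ k ∈ range (n + 1),
    poch (-n) k * poch (n - a - b - 1) k * poch (-x) k / (poch (-a) k * (k.factorial : ℝ))
      * poch (-M + k) (n - k)

theorem poch_split (a : ℝ) {k n : ℕ} (h : k ≤ n) :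
    poch a n = poch a k * poch (a + k) (n - k) := by
  obtain ⟨m, rfl⟩ := Nat.exists_eq_add_of_le h
  simp [poch, ← ascPochhammer_mul]

theorem hahnCleared_eq (n : ℕ) (x a b M : ℝ) (h : poch (-M) n ≠ 0) :
    hahnCleared n x a b M = poch (-M) n * hahn n x a b M := by
  unfold hahnCleared hahn
  rw [mul_sum]
  refine sum_congr rfl fun k hk => ?_
  have hs := poch_split (-M) (Nat.lt_succ_iff.mp (mem_range.mp hk))
  have hk0 : poch (-M) k ≠ 0 := fun h0 => h (by rw [hs, h0, zero_mul])
  rw [hs, div_mul_eq_mul_div, mul_div_assoc', mul_right_comm (poch (-a) k),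
    mul_comm _ (poch (-M) k), mul_assoc (poch (-M) k), mul_div_mul_left _ _ hk0, mul_comm (poch _ (n - k))]

variable {d : ℕ}

/-- `|ν^{j+1}| = ν_{j+1} + ⋯ + ν_d`. -/
def tailSum (ν : Fin d → ℕ) (j : Fin d) : ℕ := ∑ i ∈ Ioi j, ν i

/-- `α_j = (ℓ_{j+1} + ⋯ + ℓ_{d+1}) - 2 (ν_{j+1} + ⋯ + ν_d)`, an integer that may be negative. -/
def alpha (ℓ : Fin (d + 1) → ℕ) (ν : Fin d → ℕ) (j : Fin d) : ℤ :=
  (∑ i ∈ Ioi j.castSucc, (ℓ i : ℤ)) - 2 * (tailSum ν j : ℤ)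

/-- The polyhedral lattice set
`{x ∈ ℕ^d : x_i ≤ ℓ_i for 1 ≤ i ≤ d, N - ℓ_{d+1} ≤ |x| ≤ N}`. -/
def polyhedron (ℓ : Fin (d + 1) → ℕ) (N : ℕ) : Set (Fin d → ℕ) :=
  {x | (∀ i : Fin d, x i ≤ ℓ i.castSucc) ∧
    (N : ℤ) - ℓ (Fin.last d) ≤ ∑ i, (x i : ℤ) ∧ ∑ i, x i ≤ N}

/-- The index set of the Hahn polynomials on the polyhedron. -/
def indexSet (ℓ : Fin (d + 1) → ℕ) (N : ℕ) : Set (Fin d → ℕ) :=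
  {ν | ∑ i, ν i ≤ N ∧ ((∑ i, ν i : ℕ) : ℤ) ≤ ((∑ i, ℓ i : ℕ) : ℤ) - N ∧
    ∀ j : Fin d, ν j ≤ ℓ j.castSucc ∧ (ν j : ℤ) ≤ alpha ℓ ν j}

/-- The Hahn polynomial in `d` variables with negative integer parameters: the product over `j` of
`(-M_j)_{ν_j} · ₃F₂(-ν_j, ν_j - ℓ_j - α_j - 1, -x_j; -ℓ_j, -M_j; 1)`, where
`M_j = N - (x_1 + ⋯ + x_{j-1}) - (ν_{j+1} + ⋯ + ν_d)`. -/
noncomputable def hahnMulti (ℓ : Fin (d + 1) → ℕ) (N : ℕ) (ν : Fin d → ℕ) (x : Fin d → ℝ) : ℝ :=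
  ∏ j : Fin d, hahnCleared (ν j) (x j) (ℓ j.castSucc) (alpha ℓ ν j)
    (N - (∑ i ∈ Iio j, x i) - tailSum ν j)

/-- The constant `B_ν(ℓ, N)`, the squared norm of the Hahn polynomial of index `ν`. -/
noncomputable def hahnNormSq (ℓ : Fin (d + 1) → ℕ) (N : ℕ) (ν : Fin d → ℕ) : ℝ :=
  (-1) ^ (∑ i, ν i) * poch (-N) (∑ i, ν i) * poch (-(∑ i, ℓ i : ℕ)) (N + ∑ i, ν i)
      / (poch (-(∑ i, ℓ i : ℕ)) N * poch (-(∑ i, ℓ i : ℕ)) (2 * ∑ i, ν i))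
    * ∏ j : Fin d,
      poch (-(alpha ℓ ν j)) (ν j) * poch (-(ℓ j.castSucc) - alpha ℓ ν j - 1) (2 * ν j)
          * ((ν j).factorial : ℝ)
        / (poch (-(ℓ j.castSucc)) (ν j) * poch (-(ℓ j.castSucc) - alpha ℓ ν j - 1) (ν j))

open Classical in
/-- The reproducing kernel of degree `n`: the sum of `Q_ν(x) Q_ν(y) / B_ν` over all `ν` in the
index set with `|ν| = n`. -/
noncomputable def kernel (ℓ : Fin (d + 1) → ℕ) (N n : ℕ) (x y : Fin d → ℝ) : ℝ :=
  ∑ ν ∈ (piAntidiag (univ : Finset (Fin d)) n).filter (fun ν => ν ∈ indexSet ℓ N),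
    hahnMulti ℓ N ν x * hahnMulti ℓ N ν y / hahnNormSq ℓ N ν

/-- Homogeneous coordinates `X = (x, N - |x|)`. -/
noncomputable def homog (N : ℕ) (x : Fin d → ℝ) : Fin (d + 1) → ℝ :=
  Fin.snoc (α := fun _ => ℝ) x (N - ∑ i, x i)

/-- `E_k(x, y; ℓ) = ∑ (-X)_γ (-Y)_γ / ((-ℓ)_γ γ!)` over `γ ∈ ℕ^{d+1}` with `|γ| = k`, `γ_i ≤ ℓ_i`. -/
noncomputable def elemE (ℓ : Fin (d + 1) → ℕ) (N k : ℕ) (x y : Fin d → ℝ) : ℝ :=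
  ∑ γ ∈ (piAntidiag (univ : Finset (Fin (d + 1))) k).filter (fun γ => ∀ i, γ i ≤ ℓ i),
    (∏ i, poch (-(homog N x i)) (γ i)) * (∏ i, poch (-(homog N y i)) (γ i))
      / ((∏ i, poch (-(ℓ i)) (γ i)) * ∏ i, ((γ i).factorial : ℝ))

/-- `ℓ_min = min {ℓ_1, …, ℓ_{d+1}}`. -/
def ellMin (ℓ : Fin (d + 1) → ℕ) : ℕ := univ.inf' univ_nonempty ℓ

end HahnPolyhedra

/-! Both sides depend continuously on `ℓ`, so `ℓ` may be perturbed to real parameters for which no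
denominator vanishes. For those, the formula holds at points with two independent sample sizes, by
induction on `d`, splitting off the first variable. Comparing the coefficients of the sums `E_k` in
the remaining variables, the induction step becomes Bateman's bilinear formula, which expands the
product of two values of a Jacobi polynomial, with the monomials `t ^ i * (1 - t) ^ j` replaced by
products of Pochhammer symbols. The replacement is harmless because the transformations of
terminating hypergeometric series behind Bateman's formula rest only on the identity
`t ^ i * (1 - t) ^ j = t ^ (i + 1) * (1 - t) ^ j + t ^ i * (1 - t) ^ (j + 1)`. -/

namespace HahnPolyhedra

open Finset

/-! ### Pochhammer symbols -/

theorem poch_zero (a : ℝ) : poch a 0 = 1 := by simp [poch]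

theorem poch_succ (a : ℝ) (k : ℕ) : poch a (k + 1) = poch a k * (a + k) :=
  ascPochhammer_succ_eval k a

theorem poch_add (a : ℝ) (k m : ℕ) : poch a (k + m) = poch a k * poch (a + k) m := by
  simpa using poch_split a (Nat.le_add_right k m)

theorem poch_succ_left (a : ℝ) (k : ℕ) : poch a (k + 1) = a * poch (a + 1) k := by
  simp [add_comm k 1, poch_add, poch_succ, poch_zero]

theorem poch_one_sub_sub (a : ℝ) (k : ℕ) : poch (1 - a - k) k = (-1) ^ k * poch a k := by
  have h := ascPochhammer_eval_neg_eq_descPochhammer (R := ℝ) (a + k - 1) k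
  rwa [descPochhammer_eval_eq_ascPochhammer, show a + k - 1 - k + 1 = a by ring,
    show -(a + k - 1) = 1 - a - k by ring] at h

theorem poch_neg_natCast (n k : ℕ) :
    poch (-(n : ℝ)) k = (-1) ^ k * (k.factorial : ℝ) * (n.choose k : ℝ) := by
  rw [poch, ascPochhammer_eval_neg_eq_descPochhammer, descPochhammer_eval_eq_descFactorial,
    Nat.descFactorial_eq_factorial_mul_choose, Nat.cast_mul, mul_assoc]

theorem poch_neg_natCast_ne_zero {n k : ℕ} (h : k ≤ n) : poch (-(n : ℝ)) k ≠ 0 := by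
  rw [poch_neg_natCast]
  have := Nat.choose_pos h
  positivity

theorem poch_neg_intCast_ne_zero {z : ℤ} {k : ℕ} (h : (k : ℤ) ≤ z) : poch (-(z : ℝ)) k ≠ 0 := by
  lift z to ℕ using by omega
  exact_mod_cast poch_neg_natCast_ne_zero (by omega)

theorem poch_ne_zero_of_irrational {a : ℝ} (ha : Irrational a) (k : ℕ) : poch a k ≠ 0 := by
  induction k with
  | zero => simp [poch_zero]
  | succ k ih => exact poch_succ a k ▸ mul_ne_zero ih (ha.add_natCast k).ne_zero

theorem poch_add_natCast_ne_zero {a : ℝ} {n i k : ℕ} (h : poch a n ≠ 0) (hik : i + k ≤ n) :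
    poch (a + i) k ≠ 0 := by
  obtain ⟨m, rfl⟩ := Nat.exists_eq_add_of_le hik
  rw [poch_add, poch_add] at h
  exact right_ne_zero_of_mul (left_ne_zero_of_mul h)

theorem poch_ne_zero_of_le {a : ℝ} {n k : ℕ} (h : poch a n ≠ 0) (hk : k ≤ n) : poch a k ≠ 0 := by
  simpa using poch_add_natCast_ne_zero (i := 0) h (by omega)

theorem add_natCast_ne_zero_of_poch {a : ℝ} {n i : ℕ} (h : poch a n ≠ 0) (hi : i < n) :
    a + i ≠ 0 := by
  simpa [poch_succ, poch_zero] using poch_add_natCast_ne_zero (k := 1) h hi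

theorem choose_succ_right_mul (n k : ℕ) :
    (n.choose (k + 1) : ℝ) * (k + 1) = n.choose k * (n - k) := by
  rcases le_or_gt k n with hk | hk
  · have h := n.choose_succ_right_eq k
    zify [hk] at h
    exact_mod_cast h
  · simp [Nat.choose_eq_zero_of_lt hk, Nat.choose_eq_zero_of_lt (Nat.lt_succ_of_lt hk)]

/-! ### Arrays satisfying the Pascal relation -/

/-- The relation satisfied by `(i, j) ↦ t ^ i * (1 - t) ^ j`, required below the antidiagonal
`i + j = n`. For such an array the three sides of the triangle `i + j ≤ n` determine each other,
and the classical transformations of terminating hypergeometric series relate sums along them. -/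
def PascalRelation (n : ℕ) (g : ℕ → ℕ → ℝ) : Prop :=
  ∀ i j, i + j < n → g i j = g (i + 1) j + g i (j + 1)

namespace PascalRelation

variable {n : ℕ} {g : ℕ → ℕ → ℝ}

theorem mono (h : PascalRelation n g) {k : ℕ} (hk : k ≤ n) : PascalRelation k g :=
  fun i j hij => h i j (hij.trans_le hk)

theorem swap (h : PascalRelation n g) : PascalRelation n fun i j => g j i :=
  fun i j hij => (h j i (add_comm i j ▸ hij)).trans (add_comm _ _)

theorem shift {p q m : ℕ} (h : PascalRelation n g) (hm : m + p + q ≤ n) :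
    PascalRelation m fun i j => g (i + p) (j + q) := fun i j hij => by
  simpa only [add_right_comm] using h (i + p) (j + q) (by omega)

end PascalRelation

theorem sum_choose_succ (k : ℕ) (u : ℕ → ℝ) :
    ∑ i ∈ range (k + 2), ((k + 1).choose i : ℝ) * u i =
      ∑ i ∈ range (k + 1), (k.choose i : ℝ) * (u i + u (i + 1)) := by
  simpa only [mul_add, sum_add_distrib] using sum_choose_succ_mul (fun i _ => u i) k

namespace PascalRelation

/-- For `g i j = t ^ i * (1 - t) ^ j` this is Pfaff's transformation. -/
theorem sum_pfaff {k : ℕ} {C : ℝ} (hC : poch C k ≠ 0) (B : ℝ) {g : ℕ → ℕ → ℝ}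
    (hg : PascalRelation k g) :
    ∑ i ∈ range (k + 1), (k.choose i : ℝ) * ((-1) ^ i * poch B i / poch C i * g i 0) =
      ∑ i ∈ range (k + 1), (k.choose i : ℝ) * (poch (C - B) i / poch C i * g i (k - i)) := by
  induction k generalizing C g with
  | zero => simp [poch_zero]
  | succ k ih =>
    have hC0 : C ≠ 0 := by simpa using add_natCast_ne_zero_of_poch hC k.succ_pos
    have hC1 : poch (C + 1) k ≠ 0 := by
      simpa using poch_add_natCast_ne_zero (i := 1) hC (by omega)
    have hshift_right := ih (poch_ne_zero_of_le hC k.le_succ) (hg.shift (p := 0) (q := 1) le_rfl)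
    have hshift_left := ih hC1 (hg.shift (p := 1) (q := 0) le_rfl)
    calc
      _ = ∑ i ∈ range (k + 1), (k.choose i : ℝ) * ((-1) ^ i * poch B i / poch C i * g i 1) +
          (C - B) / C * ∑ i ∈ range (k + 1),
            (k.choose i : ℝ) * ((-1) ^ i * poch B i / poch (C + 1) i * g (i + 1) 0) := by
        rw [sum_choose_succ, mul_sum, ← sum_add_distrib]
        refine sum_congr rfl fun i hi => ?_
        have hi : i < k + 1 := mem_range.mp hi
        have hCi : poch C i ≠ 0 := poch_ne_zero_of_le hC hi.le
        have hadd : C + i ≠ 0 := add_natCast_ne_zero_of_poch hC hi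
        have hCi' : poch (C + 1) i = poch C i * (C + i) / C := by
          rw [eq_div_iff hC0, ← poch_succ, poch_succ_left, mul_comm]
        rw [hCi', poch_succ, poch_succ, hg i 0 hi, pow_succ]
        field_simp
        ring
      _ = ∑ i ∈ range (k + 1), (k.choose i : ℝ) * (poch (C - B) i / poch C i * g i (k - i + 1)) +
          (C - B) / C * ∑ i ∈ range (k + 1),
            (k.choose i : ℝ) * (poch (C + 1 - B) i / poch (C + 1) i * g (i + 1) (k - i)) := by
        exact congrArg₂ (· + (C - B) / C * ·) hshift_right hshift_left
      _ = _ := by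
        rw [sum_choose_succ, mul_sum, ← sum_add_distrib]
        refine sum_congr rfl fun i hi => ?_
        rw [Nat.add_sub_add_right, Nat.sub_add_comm (mem_range_succ_iff.mp hi),
          poch_succ_left (C - B), poch_succ_left C, sub_add_eq_add_sub, mul_div_mul_comm]
        ring

/-- For `g i j = t ^ i * (1 - t) ^ j` this is the connection formula between the terminating Gauss
series at `t` and at `1 - t`. -/
theorem sum_gauss {k : ℕ} {B C : ℝ} (hC : poch C k ≠ 0) (hD : poch (1 + B - C - k) k ≠ 0)
    {g : ℕ → ℕ → ℝ} (hg : PascalRelation k g) :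
    ∑ i ∈ range (k + 1), (k.choose i : ℝ) * ((-1) ^ i * poch B i / poch C i * g i 0) =
      poch (C - B) k / poch C k * ∑ i ∈ range (k + 1),
        (k.choose i : ℝ) * ((-1) ^ i * poch B i / poch (1 + B - C - k) i * g 0 i) := by
  rw [hg.sum_pfaff hC, hg.swap.sum_pfaff hD, ← sum_range_reflect, mul_sum]
  refine sum_congr rfl fun i hi => ?_
  obtain ⟨t, rfl⟩ := Nat.exists_eq_add_of_le' (mem_range_succ_iff.mp hi)
  have hnum : poch (1 + B - C - (t + i : ℕ) - B) i = (-1) ^ i * poch (C + t) i := by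
    rw [← poch_one_sub_sub]
    push_cast
    ring_nf
  have hden : poch (1 + B - C - (t + i : ℕ)) i = (-1) ^ i * poch (C - B + t) i := by
    rw [← poch_one_sub_sub]
    push_cast
    ring_nf
  have hden0 := right_ne_zero_of_mul (hden ▸ poch_ne_zero_of_le hD (Nat.le_add_left i t))
  rw [poch_add] at hC
  have hCt := left_ne_zero_of_mul hC
  have hCi := right_ne_zero_of_mul hC
  rw [hnum, hden, poch_add, poch_add, show t + i + 1 - 1 - i = t by omega, Nat.add_sub_cancel_left,
    Nat.add_sub_cancel, Nat.choose_symm_add]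
  field_simp

theorem eq_sum_choose {r : ℕ} {g : ℕ → ℕ → ℝ} (hg : PascalRelation r g) :
    g r 0 = ∑ q ∈ range (r + 1), (r.choose q : ℝ) * ((-1) ^ q * g 0 q) := by
  have hpos : ∀ i, poch 1 i ≠ 0 := fun i => (ascPochhammer_pos i (1 : ℝ) one_pos).ne'
  have h := hg.swap.sum_pfaff (hpos r) 1
  simp only [mul_div_cancel_right₀ _ (hpos _), sub_self] at h
  calc
    g r 0 = ∑ i ∈ range (r + 1), (r.choose i : ℝ) * (poch 0 i / poch 1 i * g (r - i) i) := by
      rw [sum_range_succ', sum_eq_zero fun i _ => by simp [poch_succ_left]]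
      simp [poch_zero]
    _ = _ := h.symm.trans (sum_congr rfl fun q _ => by ring)

end PascalRelation

theorem sum_chu_vandermonde {k : ℕ} {C : ℝ} (hC : poch C k ≠ 0) (B : ℝ) :
    ∑ i ∈ range (k + 1), (-1) ^ i * (k.choose i : ℝ) * poch B i / poch C i =
      poch (C - B) k / poch C k := by
  have hdelta : PascalRelation k fun _ j => if j = 0 then 1 else 0 := fun i j _ => by simp
  calc
    _ = ∑ i ∈ range (k + 1), (k.choose i : ℝ) *
          (poch (C - B) i / poch C i * if k - i = 0 then 1 else 0) :=
      (sum_congr rfl fun i _ => by rw [if_pos rfl]; ring).trans (hdelta.sum_pfaff hC B)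
    _ = _ := by
      rw [sum_range_succ, sum_eq_zero fun i hi => by
        simp [Nat.sub_ne_zero_of_lt (mem_range.mp hi)]]
      simp

/-! ### Divided differences on a quadratic lattice -/

/-- The coefficient of `f m` in `q!` times the divided difference of `f` on the nodes
`i * (i + c)`, `i ≤ q`, that is `q! / ∏ (i * (i + c) - m * (m + c))` over `i ≤ q`, `i ≠ m`. -/
noncomputable def newtonWeight (c : ℝ) (q m : ℕ) : ℝ :=
  (-1) ^ m * (q.choose m : ℝ) * (c + 2 * m) / poch (c + m) (q + 1)

theorem newtonWeight_eq_zero {c : ℝ} {q m : ℕ} (h : q < m) : newtonWeight c q m = 0 := by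
  simp [newtonWeight, Nat.choose_eq_zero_of_lt h]

theorem newtonWeight_zero {c : ℝ} (hc : c ≠ 0) (m : ℕ) :
    newtonWeight c 0 m = if m = 0 then 1 else 0 := by
  cases m <;> simp [newtonWeight, poch_succ, poch_zero, hc]

theorem newtonWeight_succ_mul {c : ℝ} {q m : ℕ} (h : c + m + (q + 1) ≠ 0) :
    newtonWeight c (q + 1) m * ((q + 1 - m) * (q + 1 + m + c)) =
      (q + 1) * newtonWeight c q m := by
  have hchoose : ((q + 1).choose m : ℝ) * (q + 1 - m) = (q + 1) * q.choose m := by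
    have habsorb : ((q : ℝ) + 1) * q.choose m = (q + 1).choose (m + 1) * (m + 1) := by
      exact_mod_cast q.add_one_mul_choose_eq m
    rw [habsorb, choose_succ_right_mul, Nat.cast_succ]
  rw [newtonWeight, newtonWeight, poch_succ (c + m) (q + 1), Nat.cast_succ,
    show (q : ℝ) + 1 + m + c = c + m + (q + 1) by ring, div_mul_eq_mul_div, ← mul_assoc,
    mul_div_mul_right _ _ h, mul_right_comm, mul_assoc _ _ ((q : ℝ) + 1 - m), hchoose]
  ring

theorem sum_range_newtonWeight_succ {c : ℝ} {q s : ℕ} (hc : poch c (s + q + 2) ≠ 0) :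
    ∑ m ∈ range (s + 1), newtonWeight c (q + 1) m =
      (-1) ^ s * (q.choose s : ℝ) / poch (c + s + 1) (q + 1) := by
  induction s with
  | zero =>
    have hc0 : c ≠ 0 := by simpa using add_natCast_ne_zero_of_poch hc (i := 0) (by omega)
    simp [newtonWeight, poch_succ_left c, div_mul_cancel_left₀ hc0]
  | succ s ih =>
    have hleft : poch (c + s + 1) (q + 2) = (c + s + 1) * poch (c + s + 1 + 1) (q + 1) :=
      poch_succ_left _ _
    have hright : poch (c + s + 1) (q + 2) = poch (c + s + 1) (q + 1) * (c + s + 1 + (q + 1)) := by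
      exact_mod_cast poch_succ (c + s + 1) (q + 1)
    have hne : poch (c + s + 1) (q + 2) ≠ 0 := by
      have := poch_add_natCast_ne_zero (i := s + 1) (k := q + 2) hc (by omega)
      rwa [Nat.cast_succ, ← add_assoc] at this
    have hne_left := hleft ▸ hne
    have hne_right := hright ▸ hne
    rw [sum_range_succ, ih (poch_ne_zero_of_le hc (by omega)), newtonWeight, Nat.cast_succ,
      ← add_assoc c, hleft,
      ← mul_div_mul_right _ (poch (c + s + 1) (q + 1)) (right_ne_zero_of_mul hne_right),
      ← hright, hleft, ← add_div,
      ← mul_div_mul_left _ (poch (c + s + 1 + 1) (q + 1)) (left_ne_zero_of_mul hne_left)]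
    congr 1
    push_cast [Nat.choose_succ_succ']
    linear_combination -(-1) ^ s * choose_succ_right_mul q s

theorem sum_newtonWeight {c : ℝ} {q n : ℕ} (hq : q ≤ n) (hc : poch c (2 * n + 1) ≠ 0) :
    ∑ m ∈ range (n + 1), newtonWeight c q m = if q = 0 then 1 else 0 := by
  rw [← sum_subset (range_subset_range.mpr (Nat.succ_le_succ hq)) fun m _ hm =>
    newtonWeight_eq_zero (by simpa using hm)]
  rcases q with - | q
  · have hc0 : c ≠ 0 := by simpa using add_natCast_ne_zero_of_poch hc (i := 0) (by omega)
    simp [newtonWeight_zero hc0]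
  · rw [sum_range_newtonWeight_succ (poch_ne_zero_of_le hc (by omega))]
    simp

theorem sum_newtonWeight_mul_poch {c : ℝ} {n : ℕ} (hc : poch c (2 * n + 1) ≠ 0) (x : ℝ) (j : ℕ)
    {q : ℕ} (hq : q ≤ n) :
    ∑ m ∈ range (n + 1), newtonWeight c q m * (poch (m - x) j * poch (-c - x - m) j) =
      q.factorial * j.choose q * (poch (q - x) (j - q) * poch (-c - x) (j - q)) := by
  have hc0 : c ≠ 0 := by simpa using add_natCast_ne_zero_of_poch hc (i := 0) (by omega)
  induction j generalizing q with
  | zero => cases q <;> simp [poch_zero, sum_newtonWeight hq hc]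
  | succ j ih =>
    rcases q with - | q
    · simp [newtonWeight_zero hc0]
    have hrec : ∑ m ∈ range (n + 1),
        newtonWeight c (q + 1) m * (poch (m - x) (j + 1) * poch (-c - x - m) (j + 1)) =
        (x - j - (q + 1)) * (x - j + (q + 1) + c) *
          ∑ m ∈ range (n + 1), newtonWeight c (q + 1) m * (poch (m - x) j * poch (-c - x - m) j) +
        (q + 1) * ∑ m ∈ range (n + 1), newtonWeight c q m *
          (poch (m - x) j * poch (-c - x - m) j) := by
      rw [mul_sum, mul_sum, ← sum_add_distrib]
      refine sum_congr rfl fun m hm => ?_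
      have hm := mem_range_succ_iff.mp hm
      have hne : c + m + (q + 1) ≠ 0 := by
        have := add_natCast_ne_zero_of_poch (i := m + (q + 1)) hc (by omega)
        rwa [Nat.cast_add, ← add_assoc, Nat.cast_succ] at this
      rw [poch_succ, poch_succ]
      linear_combination (poch (m - x) j * poch (-c - x - m) j) * newtonWeight_succ_mul hne
    rw [hrec, ih hq, ih (by omega)]
    rcases lt_trichotomy j q with h | rfl | h
    · simp [Nat.choose_eq_zero_of_lt, h, h.trans q.lt_succ_self]
    · simp [poch_zero, Nat.factorial_succ]
    · obtain ⟨r, rfl⟩ : ∃ r, j = q + 1 + r := Nat.exists_eq_add_of_le h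
      have hchoose := choose_succ_right_mul (q + 1 + r) q
      push_cast at hchoose
      rw [show q + 1 + r - (q + 1) = r by omega, show q + 1 + r - q = r + 1 by omega,
        show q + 1 + r + 1 - (q + 1) = r + 1 by omega, Nat.factorial_succ, Nat.choose_succ_succ',
        poch_succ_left ((q : ℝ) - x), show (q : ℝ) - x + 1 = q + 1 - x by ring,
        poch_succ (-c - x), Nat.cast_succ, poch_succ ((q : ℝ) + 1 - x)]
      push_cast
      linear_combination ((q : ℝ) + 1) * q.factorial * poch (q + 1 - x) r * poch (-c - x) r *
        (-c - x + r) * hchoose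

/-! ### Bateman's bilinear formula -/

theorem sum_range_choose_mul {k n : ℕ} (h : k ≤ n) (f : ℕ → ℝ) :
    ∑ i ∈ range (n + 1), (k.choose i : ℝ) * f i = ∑ i ∈ range (k + 1), (k.choose i : ℝ) * f i := by
  refine (sum_subset (range_subset_range.mpr (Nat.succ_le_succ h)) fun i _ hi => ?_).symm
  simp [Nat.choose_eq_zero_of_lt (n := k) (k := i) (by simpa using hi)]

theorem sum_range_add_of_eq_zero {q k : ℕ} {f : ℕ → ℝ} (h : ∀ i < q, f i = 0) :
    ∑ i ∈ range (q + k + 1), f i = ∑ i ∈ range (k + 1), f (q + i) := by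
  rw [add_assoc, sum_range_add, sum_eq_zero fun i hi => h i (mem_range.mp hi), zero_add]

theorem choose_add_mul_choose (n q i : ℕ) :
    (n.choose (q + i) * (q + i).choose q : ℝ) = n.choose q * (n - q).choose i := by
  have h := n.choose_mul (Nat.le_add_right q i)
  rw [Nat.add_sub_cancel_left] at h
  exact_mod_cast h

theorem poch_add_add_succ (c : ℝ) (m i : ℕ) :
    poch (c + m) (m + i + 1) = poch (c + m) (m + 1) * poch (c + 2 * m + 1) i := by
  rw [add_right_comm, poch_add]
  push_cast
  ring_nf

theorem choose_mul_newtonWeight {c : ℝ} {m p i : ℕ} (hc : poch (c + m) (m + p + 1) ≠ 0)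
    (hi : i ≤ p) :
    ((m + p).choose (m + i) : ℝ) * newtonWeight c (m + i) m =
      p.choose i * (poch (c + 2 * m + 1) p / poch (c + 2 * m + 1) i) *
        newtonWeight c (m + p) m := by
  have hchoose := choose_add_mul_choose (m + p) m i
  rw [Nat.add_sub_cancel_left] at hchoose
  rw [poch_add_add_succ] at hc
  have hm := left_ne_zero_of_mul hc
  have hp := right_ne_zero_of_mul hc
  have hi := poch_ne_zero_of_le hp hi
  rw [newtonWeight, newtonWeight, poch_add_add_succ, poch_add_add_succ]
  field_simp
  linear_combination (c + 2 * m) * hchoose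

theorem sum_newtonWeight_mul_choose {c : ℝ} {n q : ℕ} (hq : q ≤ n) (hc : poch c (2 * n + 1) ≠ 0)
    (j : ℕ) :
    (n.choose q : ℝ) * ∑ m ∈ range (n + 1),
        newtonWeight c q m * ((n - m).choose j * poch (-c - n - m) j) =
      (-1) ^ q * (n.choose j * j.choose q * poch (-c - n) (j - q)) := by
  have hfalling : ∀ m ≤ n, ((n - m).choose j : ℝ) = (-1) ^ j * poch (m - n) j / j.factorial :=
    fun m hm => by
      have h := poch_neg_natCast (n - m) j
      rw [Nat.cast_sub hm, neg_sub] at h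
      rw [h, ← mul_assoc, ← mul_assoc, ← pow_add, Even.neg_one_pow ⟨j, rfl⟩, one_mul,
        mul_div_cancel_left₀ _ (by positivity)]
  have hsum : ∑ m ∈ range (n + 1), newtonWeight c q m * ((n - m).choose j * poch (-c - n - m) j) =
      (-1) ^ j / j.factorial *
        (q.factorial * j.choose q * (poch (q - n) (j - q) * poch (-c - n) (j - q))) := by
    rw [← sum_newtonWeight_mul_poch hc n j hq, mul_sum]
    refine sum_congr rfl fun m hm => ?_
    rw [hfalling m (mem_range_succ_iff.mp hm)]
    ring
  rw [hsum]
  rcases lt_or_ge j q with hjq | hqj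
  · simp [Nat.choose_eq_zero_of_lt hjq]
  obtain ⟨r, rfl⟩ := Nat.exists_eq_add_of_le hqj
  have hpoch : poch (q - n) r = (-1) ^ r * r.factorial * (n - q).choose r := by
    rw [← poch_neg_natCast, Nat.cast_sub hq, neg_sub]
  have hfactorial : ((q + r).choose q * q.factorial * r.factorial : ℝ) = (q + r).factorial := by
    have h := Nat.choose_mul_factorial_mul_factorial (Nat.le_add_right q r)
    rw [Nat.add_sub_cancel_left] at h
    exact_mod_cast h
  have hsign : (-1 : ℝ) ^ r * (-1) ^ r = 1 := pow_mul_pow_eq_one _ (by norm_num)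
  rw [Nat.add_sub_cancel_left, hpoch, choose_add_mul_choose, pow_add]
  field_simp
  linear_combination n.choose q * (n - q).choose r * poch (-c - n) r *
    ((q + r).choose q * q.factorial * r.factorial * hsign + hfactorial)

/-- The Jacobi polynomial `₂F₁(-(n - m), n + m + A + c; A; t)`, with each `t ^ i * (1 - t) ^ m`
replaced by the entry `e i m` of an array. -/
noncomputable def jacobiSum (n : ℕ) (A c : ℝ) (m : ℕ) (e : ℕ → ℕ → ℝ) : ℝ :=
  ∑ i ∈ range (n - m + 1),
    ((n - m).choose i : ℝ) * ((-1) ^ i * poch (n + m + A + c) i / poch A i * e i m)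

/-- The weight of `jacobiSum n A c m` in Bateman's bilinear formula. -/
noncomputable def jacobiWeight (n : ℕ) (A c : ℝ) (m : ℕ) : ℝ :=
  (-1) ^ n * poch A (n - m) * poch (n + A + c) m * newtonWeight c n m

section

variable {n : ℕ} {A c : ℝ} {e e' : ℕ → ℕ → ℝ}

theorem jacobiSum_eq_sum_diag {m : ℕ} (hm : m ≤ n) (hA : poch A n ≠ 0)
    (he : PascalRelation n e) :
    jacobiSum n A c m e = ∑ j ∈ range (n + 1),
      ((n - m).choose j : ℝ) * (poch (-c - n - m) j / poch A j * e j (n - j)) := by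
  have hpfaff := (he.shift (m := n - m) (p := 0) (q := m) (by omega)).sum_pfaff
    (poch_ne_zero_of_le hA (n.sub_le m)) (n + m + A + c)
  simp only [add_zero, zero_add] at hpfaff
  rw [jacobiSum, sum_range_choose_mul (n.sub_le m), hpfaff]
  refine sum_congr rfl fun j hj => ?_
  have hj := mem_range_succ_iff.mp hj
  rw [show n - m - j + m = n - j by omega, show A - (n + m + A + c) = -c - n - m by ring]

theorem jacobiWeight_mul_jacobiSum {m : ℕ} (hm : m ≤ n) (hA : poch A n ≠ 0)
    (hc : poch c (2 * n + 1) ≠ 0) (he : PascalRelation n e) :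
    jacobiWeight n A c m * jacobiSum n A c m e = ∑ q ∈ range (n + 1),
      (-1) ^ q * (n.choose q : ℝ) * poch (n + A + c) q * newtonWeight c q m * e 0 q := by
  obtain ⟨p, rfl⟩ := Nat.exists_eq_add_of_le hm
  have hcm : poch (c + m) (m + p + 1) ≠ 0 := poch_add_natCast_ne_zero hc (by omega)
  have hD : 1 + ((m + p : ℕ) + m + A + c) - A - p = c + 2 * m + 1 := by push_cast; ring
  have hD0 : poch (c + 2 * m + 1) p ≠ 0 :=
    right_ne_zero_of_mul (poch_add_add_succ c m p ▸ hcm)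
  have hgauss := (he.shift (m := p) (p := 0) (q := m) (by omega)).sum_gauss
    (poch_ne_zero_of_le hA (by omega)) (hD ▸ hD0)
  have hreflect : poch (A - ((m + p : ℕ) + m + A + c)) p = (-1) ^ p * poch (c + 2 * m + 1) p := by
    rw [← poch_one_sub_sub]
    push_cast
    ring_nf
  have hA0 : poch A p * (poch A p)⁻¹ = 1 := mul_inv_cancel₀ (poch_ne_zero_of_le hA (by omega))
  simp only [add_zero, zero_add, hD, hreflect] at hgauss
  rw [jacobiSum, jacobiWeight, Nat.add_sub_cancel_left, hgauss,
    sum_range_add_of_eq_zero fun q hq => by simp [newtonWeight_eq_zero hq], mul_sum, mul_sum]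
  refine sum_congr rfl fun i hi => ?_
  have hsign : (-1 : ℝ) ^ p * (-1) ^ p = 1 := pow_mul_pow_eq_one _ (by norm_num)
  have hweight := choose_mul_newtonWeight hcm (mem_range_succ_iff.mp hi)
  calc
    _ = (-1) ^ (m + i) * poch ((m + p : ℕ) + A + c) (m + i) * e 0 (m + i) *
        (p.choose i * (poch (c + 2 * m + 1) p / poch (c + 2 * m + 1) i) *
          newtonWeight c (m + p) m) := by
      rw [poch_add _ m i, add_comm i m, pow_add, pow_add,
        show ((m + p : ℕ) : ℝ) + m + A + c = (m + p : ℕ) + A + c + m by ring]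
      linear_combination (-1) ^ m * (-1) ^ i * poch ((m + p : ℕ) + A + c) m *
        poch ((m + p : ℕ) + A + c + m) i * e 0 (m + i) * p.choose i *
        (poch (c + 2 * m + 1) p / poch (c + 2 * m + 1) i) * newtonWeight c (m + p) m *
        ((-1) ^ p * (-1) ^ p * hA0 + hsign)
    _ = _ := by
      rw [← hweight]
      ring

theorem sum_choose_mul_choose_eq_sum_diag {q : ℕ} (hq : q ≤ n) (hA : poch A n ≠ 0)
    (he : PascalRelation n e) :
    ∑ r ∈ range (n + 1), (n.choose r : ℝ) * r.choose q *
        ((-1) ^ r * poch (n + A + c) r / poch A r * e r 0) =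
      (-1) ^ q * ∑ j ∈ range (n + 1), (n.choose j : ℝ) * j.choose q *
        (poch (n + A + c) q * poch (-c - n) (j - q) / poch A j * e j (n - j)) := by
  obtain ⟨k, rfl⟩ := Nat.exists_eq_add_of_le hq
  have hAq : poch (A + q) k ≠ 0 := poch_add_natCast_ne_zero hA le_rfl
  have hpfaff := (he.shift (m := k) (p := q) (q := 0) (by omega)).sum_pfaff hAq
    ((q + k : ℕ) + A + c + q)
  simp only [add_zero] at hpfaff
  rw [sum_range_add_of_eq_zero fun r hr => by simp [Nat.choose_eq_zero_of_lt hr],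
    sum_range_add_of_eq_zero fun j hj => by simp [Nat.choose_eq_zero_of_lt hj]]
  calc
    _ = (-1) ^ q * ((q + k).choose q * (poch ((q + k : ℕ) + A + c) q / poch A q)) *
        ∑ i ∈ range (k + 1), (k.choose i : ℝ) *
          ((-1) ^ i * poch ((q + k : ℕ) + A + c + q) i / poch (A + q) i * e (i + q) 0) := by
      rw [mul_sum]
      refine sum_congr rfl fun i _ => ?_
      rw [choose_add_mul_choose, Nat.add_sub_cancel_left, pow_add, poch_add, poch_add A,
        add_comm q i]
      ring
    _ = _ := by
      rw [hpfaff, mul_assoc, mul_sum]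
      congr 1
      refine sum_congr rfl fun i _ => ?_
      rw [choose_add_mul_choose, Nat.add_sub_cancel_left, Nat.add_sub_cancel_left,
        Nat.add_sub_add_left, poch_add A, add_comm q i,
        show A + q - ((q + k : ℕ) + A + c + q) = -c - (q + k : ℕ) by ring]
      ring

theorem sum_jacobiWeight_mul_jacobiSum_eq_sum_diag (hA : poch A n ≠ 0) (hc : poch c (2 * n + 1) ≠ 0)
    (he : PascalRelation n e) (he' : PascalRelation n e') :
    ∑ m ∈ range (n + 1), jacobiWeight n A c m * (jacobiSum n A c m e * jacobiSum n A c m e') =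
      ∑ q ∈ range (n + 1), e 0 q * ∑ j ∈ range (n + 1), (n.choose j : ℝ) * j.choose q *
        (poch (n + A + c) q * poch (-c - n) (j - q) / poch A j * e' j (n - j)) := by
  calc
    _ = ∑ q ∈ range (n + 1), ∑ j ∈ range (n + 1),
        (-1) ^ q * poch (n + A + c) q / poch A j * e 0 q * e' j (n - j) *
          ((n.choose q : ℝ) * ∑ m ∈ range (n + 1),
            newtonWeight c q m * ((n - m).choose j * poch (-c - n - m) j)) := by
      simp only [mul_sum]
      rw [sum_congr rfl fun q _ => sum_comm, sum_comm]
      refine sum_congr rfl fun m hm => ?_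
      have hm := mem_range_succ_iff.mp hm
      rw [← mul_assoc, jacobiWeight_mul_jacobiSum hm hA hc he, jacobiSum_eq_sum_diag hm hA he',
        sum_mul_sum]
      exact sum_congr rfl fun q _ => sum_congr rfl fun j _ => by ring
    _ = _ := by
      refine sum_congr rfl fun q hq => ?_
      rw [mul_sum]
      refine sum_congr rfl fun j _ => ?_
      have hsign : (-1 : ℝ) ^ q * (-1) ^ q = 1 := pow_mul_pow_eq_one _ (by norm_num)
      rw [sum_newtonWeight_mul_choose (mem_range_succ_iff.mp hq) hc]
      linear_combination n.choose j * j.choose q * poch (n + A + c) q * poch (-c - n) (j - q) /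
        poch A j * e 0 q * e' j (n - j) * hsign

theorem sum_jacobiWeight_mul_jacobiSum (hA : poch A n ≠ 0) (hc : poch c (2 * n + 1) ≠ 0)
    (he : PascalRelation n e) (he' : PascalRelation n e') :
    ∑ m ∈ range (n + 1), jacobiWeight n A c m * (jacobiSum n A c m e * jacobiSum n A c m e') =
      ∑ r ∈ range (n + 1), (n.choose r : ℝ) *
        ((-1) ^ r * poch (n + A + c) r / poch A r * (e r 0 * e' r 0)) := by
  rw [sum_jacobiWeight_mul_jacobiSum_eq_sum_diag hA hc he he']
  calc
    _ = ∑ q ∈ range (n + 1), (-1) ^ q * e 0 q * ∑ r ∈ range (n + 1), (n.choose r : ℝ) *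
        r.choose q * ((-1) ^ r * poch (n + A + c) r / poch A r * e' r 0) := by
      refine sum_congr rfl fun q hq => ?_
      have hsign : (-1 : ℝ) ^ q * (-1) ^ q = 1 := pow_mul_pow_eq_one _ (by norm_num)
      rw [sum_choose_mul_choose_eq_sum_diag (mem_range_succ_iff.mp hq) hA he', mul_assoc,
        mul_left_comm, ← mul_assoc ((-1) ^ q), hsign, one_mul]
    _ = _ := by
      simp only [mul_sum]
      rw [sum_comm]
      refine sum_congr rfl fun r hr => ?_
      have hr := mem_range_succ_iff.mp hr
      rw [(he.mono hr).eq_sum_choose, ← sum_range_choose_mul hr, sum_mul, mul_sum, mul_sum]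
      exact sum_congr rfl fun q _ => by ring

end

/-! ### Hahn polynomials in one variable -/

/-- The Hahn analogue of the monomials `t ^ i * (1 - t) ^ j`, homogenized to degree `n`. -/
noncomputable def hahnArray (n : ℕ) (x N : ℝ) (i j : ℕ) : ℝ :=
  poch (-x) i * poch (-(N - x)) j * poch (i + j - N) (n - i - j)

theorem pascalRelation_hahnArray (n : ℕ) (x N : ℝ) : PascalRelation n (hahnArray n x N) := by
  intro i j h
  obtain ⟨t, rfl⟩ : ∃ t, n = i + j + t + 1 := ⟨n - (i + j) - 1, by omega⟩
  simp only [hahnArray]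
  rw [show i + j + t + 1 - i - j = t + 1 by omega, show i + j + t + 1 - (i + 1) - j = t by omega,
    show i + j + t + 1 - i - (j + 1) = t by omega, poch_succ_left, poch_succ, poch_succ]
  push_cast
  ring_nf

theorem hahnCleared_mul_poch {n m : ℕ} (hm : m ≤ n) (x a b N : ℝ) :
    hahnCleared (n - m) x a (b - 2 * m) (N - m) * poch (-(N - x)) m =
      jacobiSum n (-a) (-b - 1) m (hahnArray n x N) := by
  obtain ⟨k, rfl⟩ := Nat.exists_eq_add_of_le hm
  rw [hahnCleared, jacobiSum, sum_mul, Nat.add_sub_cancel_left]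
  refine sum_congr rfl fun i _ => ?_
  rw [poch_neg_natCast, hahnArray, show m + k - i - m = k - i by omega]
  push_cast
  ring_nf
  field_simp

/-- The reciprocal of the squared norm of the one-variable Hahn polynomial of degree `t` with
parameters `a`, `α`, without the factors depending on the size of the sample. -/
noncomputable def hahnWeight (a α : ℝ) (t : ℕ) : ℝ :=
  poch (-a) t / (poch (-α) t * poch (t - a - α - 1) t * t.factorial)

/-- The coefficient of `E_k` in the kernel of degree `n ≥ k`, in terms of `c = -|ℓ| - 1` and
without the factors depending on the size of the sample. -/
noncomputable def kernelCoeff (c : ℝ) (n k : ℕ) : ℝ :=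
  (-1) ^ (n + k) * poch c (n + k) * (c + 2 * n) / (c * (n - k).factorial)

theorem mul_poch_add_one_two_mul (c : ℝ) (k s t : ℕ) :
    c * poch (c + 1) (2 * (k + s + t)) =
      poch c (k + s + t + k) * (poch (c + (k + s + t + k)) s *
        (poch (c + (k + s + t + k) + s) t * (c + 2 * (k + s + t)))) := by
  rw [← poch_succ_left, show 2 * (k + s + t) + 1 = (k + s + t + k) + (s + (t + 1)) by omega,
    poch_add, poch_add _ s, poch_succ _ t]
  push_cast
  ring_nf

theorem mul_poch_add_one_mul_poch (c : ℝ) (k s t : ℕ) :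
    c * (poch (c + 1) (2 * (k + s)) * poch (c + 1 + 2 * (k + s)) t) =
      poch c (k + s + k) * poch (c + (k + s + k)) (s + t + 1) := by
  have h := poch_succ_left c (2 * (k + s) + t)
  rw [poch_add (c + 1), show 2 * (k + s) + t + 1 = (k + s + k) + (s + t + 1) by omega,
    poch_add c] at h
  push_cast at h
  exact h.symm

theorem hahnWeight_mul_kernelCoeff {a b : ℝ} {k s t : ℕ}
    (hb : poch (-b - 1) (2 * (k + s + t) + 1) ≠ 0)
    (hL : poch (-(a + b) - 1) (2 * (k + s + t) + 1) ≠ 0) :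
    poch (-(a + b)) (2 * (k + s + t)) * hahnWeight a (b - 2 * (k + s : ℕ)) t /
        poch (-b) (2 * (k + s)) * kernelCoeff (-b - 1) (k + s) k =
      kernelCoeff (-(a + b) - 1) (k + s + t) k *
        jacobiWeight (s + t) (-a) (-b - 1 + 2 * k) s := by
  have hnumer := mul_poch_add_one_two_mul (-(a + b) - 1) k s t
  have hdenom := mul_poch_add_one_mul_poch (-b - 1) k s t
  rw [poch_succ_left] at hL
  have hL0 := left_ne_zero_of_mul hL
  rw [hnumer] at hL
  have hb' := poch_ne_zero_of_le hb (k := (k + s + k) + (s + t + 1)) (by omega)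
  rw [poch_add] at hb'
  push_cast at hb'
  rw [sub_add_cancel] at hnumer hdenom
  have hb'' := hdenom ▸ hb'
  have hchoose : ((s + t).choose s : ℝ) = (s + t).factorial / (s.factorial * t.factorial) := by
    rw [Nat.cast_choose ℝ (Nat.le_add_right s t), Nat.add_sub_cancel_left]
  have hsign : (-1 : ℝ) ^ (k + s + t + k) * ((-1) ^ (s + t) * (-1) ^ s) = (-1) ^ (k + s + k) := by
    rw [← pow_add, ← pow_add, show k + s + t + k + (s + t + s) = (k + s + k) + 2 * (s + t) by ring,
      pow_add, Even.neg_one_pow ⟨s + t, two_mul _⟩, mul_one]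
  rw [hahnWeight, kernelCoeff, kernelCoeff, jacobiWeight, newtonWeight, hchoose,
    show k + s + t - k = s + t by omega, show k + s - k = s by omega, Nat.add_sub_cancel_left]
  push_cast
  rw [show -(b - 2 * ((k : ℝ) + s)) = -b + 2 * (k + s) by ring,
    show (t : ℝ) - a - (b - 2 * (k + s)) - 1 = -(a + b) - 1 + (k + s + t + k) + s by ring,
    show (s : ℝ) + t + -a + (-b - 1 + 2 * k) = -(a + b) - 1 + (k + s + t + k) by ring,
    show -b - 1 + 2 * (k : ℝ) + s = -b - 1 + (k + s + k) by ring]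
  simp only [ne_eq, mul_eq_zero, not_or] at hL hb' hb''
  obtain ⟨-, hLs, hLt, -⟩ := hL
  obtain ⟨hbm, hbst⟩ := hb'
  obtain ⟨hb1, hbm', hbt⟩ := hb''
  rw [eq_comm, ← eq_inv_mul_iff_mul_eq₀ hbm] at hdenom
  rw [← eq_inv_mul_iff_mul_eq₀ hL0] at hnumer
  rw [hnumer, hdenom]
  field_simp
  rw [← hsign]
  ring

theorem kernelCoeff_add {p j : ℕ} (hj : j ≤ p) (c : ℝ) (k : ℕ) :
    kernelCoeff c (k + p) (k + j) =
      kernelCoeff c (k + p) k *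
        ((-1) ^ j * poch (c + (k + p + k : ℕ)) j * (p.choose j * j.factorial)) := by
  rw [kernelCoeff, kernelCoeff, ← add_assoc (k + p) k j, pow_add _ (k + p + k) j, poch_add,
    Nat.add_sub_cancel_left, Nat.add_sub_add_left, Nat.cast_choose ℝ hj]
  field_simp

/-- The coefficient of `E_k` in the kernel of degree `n ≥ k` whose two arguments have sample sizes
`N` and `M`. -/
noncomputable def kernelTerm (c N M : ℝ) (n k : ℕ) : ℝ :=
  kernelCoeff c n k * (poch (k - N) (n - k) * poch (k - M) (n - k))

/-- The coefficient of the kernel of degree `m` in the remaining variables when the kernel of degree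
`n ≥ m` is expanded along its first variable, whose parameter is `a`; the other parameters add up
to `b`. -/
noncomputable def hahnTransition (a b x y N M : ℝ) (n m : ℕ) : ℝ :=
  poch (-(a + b)) (2 * n) * hahnWeight a (b - 2 * m) (n - m) / poch (-b) (2 * m) *
    (hahnCleared (n - m) x a (b - 2 * m) (N - m) * hahnCleared (n - m) y a (b - 2 * m) (M - m))

theorem hahnTransition_mul_kernelTerm {a b : ℝ} {k p s : ℕ} (hs : s ≤ p)
    (hb : poch (-b - 1) (2 * (k + p) + 1) ≠ 0)
    (hL : poch (-(a + b) - 1) (2 * (k + p) + 1) ≠ 0) (x y N M : ℝ) :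
    hahnTransition a b x y N M (k + p) (k + s) *
        kernelTerm (-b - 1) (N - x) (M - y) (k + s) k =
      kernelCoeff (-(a + b) - 1) (k + p) k * (jacobiWeight p (-a) (-b - 1 + 2 * k) s *
        (jacobiSum p (-a) (-b - 1 + 2 * k) s (hahnArray p x (N - k)) *
          jacobiSum p (-a) (-b - 1 + 2 * k) s (hahnArray p y (M - k)))) := by
  have hjacobi (x N : ℝ) : jacobiSum p (-a) (-b - 1 + 2 * k) s (hahnArray p x (N - k)) =
      hahnCleared (p - s) x a (b - 2 * (k + s : ℕ)) (N - (k + s : ℕ)) * poch (k - (N - x)) s := by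
    have h := hahnCleared_mul_poch hs x a (b - 2 * k) (N - k)
    rw [show -(b - 2 * (k : ℝ)) - 1 = -b - 1 + 2 * k by ring] at h
    rw [← h]
    push_cast
    ring_nf
  obtain ⟨t, rfl⟩ := Nat.exists_eq_add_of_le hs
  rw [← add_assoc] at hb hL ⊢
  have hweight := hahnWeight_mul_kernelCoeff hb hL
  rw [hahnTransition, kernelTerm, hjacobi, hjacobi, Nat.add_sub_cancel_left,
    Nat.add_sub_cancel_left, Nat.add_sub_cancel_left]
  linear_combination (hahnCleared t x a (b - 2 * (k + s : ℕ)) (N - (k + s : ℕ)) *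
    poch (k - (N - x)) s * (hahnCleared t y a (b - 2 * (k + s : ℕ)) (M - (k + s : ℕ)) *
    poch (k - (M - y)) s)) * hweight

theorem sum_hahnTransition_mul_kernelTerm {a b : ℝ} {k p : ℕ} (ha : poch (-a) p ≠ 0)
    (hb : poch (-b - 1) (2 * (k + p) + 1) ≠ 0)
    (hL : poch (-(a + b) - 1) (2 * (k + p) + 1) ≠ 0) (x y N M : ℝ) :
    ∑ s ∈ range (p + 1), hahnTransition a b x y N M (k + p) (k + s) *
        kernelTerm (-b - 1) (N - x) (M - y) (k + s) k =
      ∑ j ∈ range (p + 1), kernelTerm (-(a + b) - 1) N M (k + p) (k + j) *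
        (poch (-x) j * poch (-y) j / (poch (-a) j * j.factorial)) := by
  have hc : poch (-b - 1 + 2 * k) (2 * p + 1) ≠ 0 := by
    exact_mod_cast poch_add_natCast_ne_zero (i := 2 * k) hb (by omega)
  rw [sum_congr rfl fun s hs =>
      hahnTransition_mul_kernelTerm (mem_range_succ_iff.mp hs) hb hL x y N M, ← mul_sum,
    sum_jacobiWeight_mul_jacobiSum ha hc (pascalRelation_hahnArray _ _ _)
      (pascalRelation_hahnArray _ _ _), mul_sum]
  refine sum_congr rfl fun j hj => ?_
  have hpoch : (p : ℝ) + -a + (-b - 1 + 2 * k) = -(a + b) - 1 + (k + p + k : ℕ) := by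
    push_cast; ring
  rw [kernelTerm, kernelCoeff_add (mem_range_succ_iff.mp hj), hahnArray, hahnArray, poch_zero,
    poch_zero, hpoch, Nat.add_sub_add_left]
  have hsub (N : ℝ) : (j : ℝ) + (0 : ℕ) - (N - k) = (k + j : ℕ) - N := by push_cast; ring
  rw [hsub, hsub]
  simp only [mul_one, Nat.sub_zero]
  field_simp

/-! ### The kernel for real parameters -/

theorem sum_piAntidiag_fin_succ {d : ℕ} (n : ℕ) (F : (Fin (d + 1) → ℕ) → ℝ) :
    ∑ ν ∈ piAntidiag univ n, F ν =
      ∑ m ∈ range (n + 1), ∑ ν ∈ piAntidiag univ m, F (Fin.cons (n - m) ν) := by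
  have hsum (ν : Fin (d + 1) → ℕ) (hν : ν ∈ piAntidiag univ n) :
      ν 0 + ∑ i, Fin.tail ν i = n := by
    simpa [Fin.sum_univ_succ, Fin.tail] using hν
  have hcons (ν : Fin (d + 1) → ℕ) (hν : ν ∈ piAntidiag univ n) :
      Fin.cons (n - ∑ i, Fin.tail ν i) (Fin.tail ν) = ν := by
    rw [← hsum ν hν, Nat.add_sub_cancel_right, Fin.cons_self_tail]
  rw [sum_sigma']
  refine sum_nbij' (fun ν => ⟨∑ i, Fin.tail ν i, Fin.tail ν⟩) (fun p => Fin.cons (n - p.1) p.2)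
    (fun ν hν => ?_) (fun p hp => ?_) hcons (fun p hp => ?_) fun ν hν =>
      congrArg F (hcons ν hν).symm
  · simpa using Nat.lt_succ_of_le ((Nat.le_add_left _ _).trans_eq (hsum ν hν))
  all_goals
    obtain ⟨m, ν⟩ := p
    obtain ⟨hm, rfl⟩ : m < n + 1 ∧ ∑ i, ν i = m := by simpa using hp
  · simpa [Fin.sum_univ_succ] using Nat.sub_add_cancel (Nat.le_of_lt_succ hm)
  · rw [Fin.tail_cons]

variable {d : ℕ}

/-- The parameters `α_j` for real `ℓ`. -/
noncomputable def realAlpha (ℓ : Fin (d + 1) → ℝ) (ν : Fin d → ℕ) (j : Fin d) : ℝ :=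
  ∑ i ∈ Ioi j.castSucc, ℓ i - 2 * tailSum ν j

/-- The Hahn polynomial in `d` variables for real `ℓ` and real sample size `N`. -/
noncomputable def realHahnMulti (ℓ : Fin (d + 1) → ℝ) (N : ℝ) (ν : Fin d → ℕ) (x : Fin d → ℝ) : ℝ :=
  ∏ j : Fin d, hahnCleared (ν j) (x j) (ℓ j.castSucc) (realAlpha ℓ ν j)
    (N - ∑ i ∈ Iio j, x i - tailSum ν j)

/-- The reciprocal of the squared norm `B_ν` for real `ℓ`, without the factors depending on the size
of the sample. -/
noncomputable def realHahnWeight (ℓ : Fin (d + 1) → ℝ) (ν : Fin d → ℕ) : ℝ :=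
  poch (-∑ i, ℓ i) (2 * ∑ i, ν i) *
    ∏ j : Fin d, hahnWeight (ℓ j.castSucc) (realAlpha ℓ ν j) (ν j)

/-- The reproducing kernel of degree `n` for real `ℓ`, at points given by homogeneous coordinates
`X` and `Y`; their coordinate sums, the sample sizes, may differ. -/
noncomputable def realKernel (ℓ X Y : Fin (d + 1) → ℝ) (n : ℕ) : ℝ :=
  ∑ ν ∈ piAntidiag univ n, realHahnMulti ℓ (∑ i, X i) ν (Fin.init X) *
    realHahnMulti ℓ (∑ i, Y i) ν (Fin.init Y) * realHahnWeight ℓ ν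

/-- The sums `E_k` for real `ℓ`, in homogeneous coordinates. -/
noncomputable def realElemE (ℓ : Fin d → ℝ) (k : ℕ) (X Y : Fin d → ℝ) : ℝ :=
  ∑ γ ∈ piAntidiag univ k,
    ∏ i, (poch (-X i) (γ i) * poch (-Y i) (γ i) / (poch (-ℓ i) (γ i) * (γ i).factorial))

theorem sum_tail (X : Fin (d + 1) → ℝ) : ∑ i, Fin.tail X i = ∑ i, X i - X 0 :=
  eq_sub_of_add_eq' (Fin.sum_univ_succ X).symm

section Cons

variable (t : ℕ) (ν : Fin d → ℕ)

theorem tailSum_cons_zero : tailSum (Fin.cons t ν) 0 = ∑ i, ν i := by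
  simp [tailSum]

theorem tailSum_cons_succ (j : Fin d) : tailSum (Fin.cons t ν) j.succ = tailSum ν j := by
  simp [tailSum, Fin.sum_Ioi_succ]

theorem realAlpha_cons_zero (ℓ : Fin (d + 2) → ℝ) :
    realAlpha ℓ (Fin.cons t ν) 0 = ∑ i, Fin.tail ℓ i - 2 * (∑ i, ν i : ℕ) := by
  rw [realAlpha, tailSum_cons_zero, Fin.castSucc_zero, Fin.sum_Ioi_zero]
  rfl

theorem realAlpha_cons_succ (ℓ : Fin (d + 2) → ℝ) (j : Fin d) :
    realAlpha ℓ (Fin.cons t ν) j.succ = realAlpha (Fin.tail ℓ) ν j := by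
  rw [realAlpha, tailSum_cons_succ, ← Fin.succ_castSucc, Fin.sum_Ioi_succ]
  rfl

theorem sum_Iio_succ (x : Fin (d + 1) → ℝ) (j : Fin d) :
    ∑ i ∈ Iio j.succ, x i = x 0 + ∑ i ∈ Iio j, Fin.tail x i := by
  have hIio : Iio j.succ = insert 0 ((Iio j).map (Fin.succEmb d)) := by
    ext i
    cases i using Fin.cases <;> simp
  rw [hIio, sum_insert (by simp), sum_map]
  rfl

theorem realHahnMulti_cons (ℓ : Fin (d + 2) → ℝ) (N : ℝ) (x : Fin (d + 1) → ℝ) :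
    realHahnMulti ℓ N (Fin.cons t ν) x =
      hahnCleared t (x 0) (ℓ 0) (∑ i, Fin.tail ℓ i - 2 * (∑ i, ν i : ℕ)) (N - (∑ i, ν i : ℕ)) *
        realHahnMulti (Fin.tail ℓ) (N - x 0) ν (Fin.tail x) := by
  rw [realHahnMulti, Fin.prod_univ_succ, realHahnMulti]
  congr 1
  · rw [realAlpha_cons_zero, tailSum_cons_zero, ← bot_eq_zero, Iio_bot, sum_empty, sub_zero]
    rfl
  · refine prod_congr rfl fun j _ => ?_
    rw [realAlpha_cons_succ, tailSum_cons_succ, sum_Iio_succ, ← sub_sub N]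
    rfl

theorem realHahnWeight_cons {ℓ : Fin (d + 2) → ℝ}
    (h : poch (-∑ i, Fin.tail ℓ i) (2 * ∑ i, ν i) ≠ 0) :
    realHahnWeight ℓ (Fin.cons t ν) =
      poch (-(ℓ 0 + ∑ i, Fin.tail ℓ i)) (2 * (t + ∑ i, ν i)) *
        hahnWeight (ℓ 0) (∑ i, Fin.tail ℓ i - 2 * (∑ i, ν i : ℕ)) t /
          poch (-∑ i, Fin.tail ℓ i) (2 * ∑ i, ν i) * realHahnWeight (Fin.tail ℓ) ν := by
  rw [realHahnWeight, realHahnWeight, Fin.prod_univ_succ, realAlpha_cons_zero,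
    Fin.sum_univ_succ (f := ℓ), Fin.sum_univ_succ (f := (Fin.cons t ν : Fin (d + 1) → ℕ))]
  simp only [Fin.cons_zero, Fin.cons_succ, realAlpha_cons_succ, Fin.castSucc_zero,
    ← Fin.succ_castSucc]
  simp only [Fin.tail] at h ⊢
  field_simp

end Cons

/-- Genericity of real parameters: every partial sum is irrational, so that no Pochhammer symbol of
an integer shift of a partial sum vanishes. -/
def Generic {ι : Type*} (ℓ : ι → ℝ) : Prop :=
  ∀ s : Finset ι, s.Nonempty → Irrational (∑ i ∈ s, ℓ i)

theorem Generic.apply {ι : Type*} {ℓ : ι → ℝ} (h : Generic ℓ) (i : ι) : Irrational (ℓ i) := by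
  simpa using h {i} (singleton_nonempty i)

theorem Generic.tail {ℓ : Fin (d + 1) → ℝ} (h : Generic ℓ) : Generic (Fin.tail ℓ) := fun s hs => by
  simpa [Fin.tail] using h (s.map (Fin.succEmb d)) (hs.map)

theorem Generic.sum {ℓ : Fin (d + 1) → ℝ} (h : Generic ℓ) : Irrational (∑ i, ℓ i) :=
  h univ univ_nonempty

theorem realKernel_succ {ℓ : Fin (d + 2) → ℝ} (hℓ : Generic ℓ) (X Y : Fin (d + 2) → ℝ) (n : ℕ) :
    realKernel ℓ X Y n =
      ∑ m ∈ range (n + 1), hahnTransition (ℓ 0) (∑ i, Fin.tail ℓ i) (X 0) (Y 0) (∑ i, X i)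
          (∑ i, Y i) n m *
        realKernel (Fin.tail ℓ) (Fin.tail X) (Fin.tail Y) m := by
  have hb := poch_ne_zero_of_irrational hℓ.tail.sum.neg
  rw [realKernel, sum_piAntidiag_fin_succ]
  refine sum_congr rfl fun m hm => ?_
  rw [realKernel, mul_sum]
  refine sum_congr rfl fun ν hν => ?_
  obtain rfl : ∑ i, ν i = m := by simpa using hν
  rw [realHahnMulti_cons, realHahnMulti_cons, realHahnWeight_cons _ _ (hb _), hahnTransition,
    Nat.sub_add_cancel (mem_range_succ_iff.mp hm), Fin.tail_init_eq_init_tail,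
    Fin.tail_init_eq_init_tail, Fin.init, Fin.init, Fin.castSucc_zero, sum_tail X,
    sum_tail Y]
  ring

theorem realElemE_succ (ℓ : Fin (d + 1) → ℝ) (k : ℕ) (X Y : Fin (d + 1) → ℝ) :
    realElemE ℓ k X Y = ∑ i ∈ range (k + 1), poch (-X 0) (k - i) * poch (-Y 0) (k - i) /
      (poch (-ℓ 0) (k - i) * (k - i).factorial) *
        realElemE (Fin.tail ℓ) i (Fin.tail X) (Fin.tail Y) := by
  rw [realElemE, sum_piAntidiag_fin_succ]
  refine sum_congr rfl fun i _ => ?_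
  rw [realElemE, mul_sum]
  exact sum_congr rfl fun γ _ => Fin.prod_univ_succ _

theorem realElemE_fin_one (ℓ X Y : Fin 1 → ℝ) (k : ℕ) :
    realElemE ℓ k X Y = poch (-X 0) k * poch (-Y 0) k / (poch (-ℓ 0) k * k.factorial) := by
  have hzero (i : ℕ) : realElemE (Fin.tail ℓ) i (Fin.tail X) (Fin.tail Y) =
      if i = 0 then 1 else 0 := by
    cases i <;> simp [realElemE]
  simp [realElemE_succ, hzero]

theorem sum_kernelTerm_eq_zero {a : ℝ} {n : ℕ} (hn : n ≠ 0) (ha : poch (-a) n ≠ 0) (x y : ℝ) :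
    ∑ k ∈ range (n + 1), kernelTerm (-a - 1) x y n k *
      (poch (-x) k * poch (-y) k / (poch (-a) k * k.factorial)) = 0 := by
  have hterm (k : ℕ) (hk : k ∈ range (n + 1)) : kernelTerm (-a - 1) x y n k *
      (poch (-x) k * poch (-y) k / (poch (-a) k * k.factorial)) =
        kernelCoeff (-a - 1) n 0 * (poch (-x) n * poch (-y) n) *
          ((-1) ^ k * n.choose k * poch (-a - 1 + n) k / poch (-a) k) := by
    have hk := mem_range_succ_iff.mp hk
    have hcoeff := kernelCoeff_add hk (-a - 1) 0
    simp only [zero_add, add_zero] at hcoeff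
    rw [kernelTerm, hcoeff, poch_split (-x) hk, poch_split (-y) hk, neg_add_eq_sub, neg_add_eq_sub]
    field_simp
  obtain ⟨m, rfl⟩ := Nat.exists_eq_succ_of_ne_zero hn
  have hpoch : poch (-a - (-a - 1 + (m + 1 : ℕ))) (m + 1) = 0 := by
    rw [show -a - (-a - 1 + ((m + 1 : ℕ) : ℝ)) = -m by push_cast; ring, poch_neg_natCast,
      Nat.choose_succ_self, Nat.cast_zero, mul_zero]
  rw [sum_congr rfl hterm, ← mul_sum, sum_chu_vandermonde ha, hpoch, zero_div, mul_zero]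

theorem realKernel_fin_one {ℓ : Fin 1 → ℝ} (hℓ : Generic ℓ) (X Y : Fin 1 → ℝ) (n : ℕ) :
    realKernel ℓ X Y n =
      ∑ k ∈ range (n + 1), kernelTerm (-∑ i, ℓ i - 1) (∑ i, X i) (∑ i, Y i) n k *
        realElemE ℓ k X Y := by
  simp only [realElemE_fin_one, Fin.sum_univ_one]
  rcases eq_or_ne n 0 with rfl | hn
  · have h : -ℓ 0 - 1 ≠ 0 := by simpa using ((hℓ.apply 0).neg.sub_natCast 1).ne_zero
    simp [realKernel, realHahnMulti, realHahnWeight, kernelTerm, kernelCoeff, poch_zero, h]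
  · rw [sum_kernelTerm_eq_zero hn (poch_ne_zero_of_irrational (hℓ.apply 0).neg _), realKernel,
      univ_eq_empty, piAntidiag_empty_of_ne_zero hn, sum_empty]

theorem sum_range_sum_range_eq (n : ℕ) (g : ℕ → ℕ → ℝ) :
    ∑ m ∈ range (n + 1), ∑ k ∈ range (m + 1), g m k =
      ∑ k ∈ range (n + 1), ∑ s ∈ range (n - k + 1), g (k + s) k := by
  have hleft : ∑ m ∈ range (n + 1), ∑ k ∈ range (m + 1), g m k =
      ∑ m ∈ range (n + 1), ∑ k ∈ range (m + 1), g (k + (m - k)) k :=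
    sum_congr rfl fun m _ => sum_congr rfl fun k hk => by
      rw [Nat.add_sub_cancel' (mem_range_succ_iff.mp hk)]
  rw [hleft, sum_range_diag_flip (n + 1) fun k s => g (k + s) k]
  exact sum_congr rfl fun k hk => by rw [← Nat.sub_add_comm (mem_range_succ_iff.mp hk)]

theorem realKernel_eq_sum {ℓ : Fin (d + 1) → ℝ} (hℓ : Generic ℓ) (X Y : Fin (d + 1) → ℝ) (n : ℕ) :
    realKernel ℓ X Y n =
      ∑ k ∈ range (n + 1), kernelTerm (-∑ i, ℓ i - 1) (∑ i, X i) (∑ i, Y i) n k *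
        realElemE ℓ k X Y := by
  induction d generalizing n with
  | zero => exact realKernel_fin_one hℓ X Y n
  | succ d ih =>
    have hsum : -(ℓ 0 + ∑ i, Fin.tail ℓ i) = -∑ i, ℓ i := by
      rw [sum_tail, add_sub_cancel]
    have ha := poch_ne_zero_of_irrational (hℓ.apply 0).neg
    have hb := poch_ne_zero_of_irrational (hℓ.tail.sum.neg.sub_natCast 1)
    have hL := poch_ne_zero_of_irrational (hℓ.sum.neg.sub_natCast 1)
    rw [Nat.cast_one] at hb hL
    rw [← hsum] at hL
    simp only [realKernel_succ hℓ, ih hℓ.tail, realElemE_succ ℓ, mul_sum]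
    rw [sum_range_sum_range_eq, sum_range_sum_range_eq]
    refine sum_congr rfl fun k hk => ?_
    obtain ⟨p, rfl⟩ := Nat.exists_eq_add_of_le (mem_range_succ_iff.mp hk)
    have h := sum_hahnTransition_mul_kernelTerm (k := k) (ha p) (hb _) (hL _) (X 0) (Y 0)
      (∑ i, X i) (∑ i, Y i)
    rw [hsum, ← sum_tail, ← sum_tail] at h
    simp only [Nat.add_sub_cancel_left, ← mul_assoc, ← sum_mul]
    rw [h]

/-! ### The kernel for natural parameters -/

variable {n : ℕ} {ℓ : Fin (d + 1) → ℕ}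

theorem realAlpha_natCast (ℓ : Fin (d + 1) → ℕ) (ν : Fin d → ℕ) (j : Fin d) :
    realAlpha (fun i => (ℓ i : ℝ)) ν j = alpha ℓ ν j := by
  simp [realAlpha, alpha]

theorem add_tailSum_le_sum (ν : Fin d → ℕ) (j : Fin d) : ν j + tailSum ν j ≤ ∑ i, ν i := by
  rw [tailSum, ← sum_insert (by simp)]
  exact sum_le_sum_of_subset (subset_univ _)

theorem add_two_mul_tailSum_le {ν : Fin d → ℕ} (hν : ∀ j, ∑ i, ν i ≤ ℓ j) (j : Fin d) :
    ν j + 2 * tailSum ν j ≤ ∑ i ∈ Ioi j.castSucc, ℓ i := by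
  have hle := add_tailSum_le_sum ν j
  have hcard : (d - j) * ∑ i, ν i ≤ ∑ i ∈ Ioi j.castSucc, ℓ i := by
    simpa using card_nsmul_le_sum (Ioi j.castSucc) ℓ _ fun i _ => hν i
  rcases Nat.lt_or_ge (j + 1) d with hj | hj
  · have := Nat.mul_le_mul_right (∑ i, ν i) (show 2 ≤ d - j by omega)
    omega
  · have htail : tailSum ν j = 0 := by
      refine sum_eq_zero fun i hi => ?_
      have := mem_Ioi.mp hi
      omega
    rw [show d - (j : ℕ) = 1 by omega] at hcard
    omega

theorem le_alpha {ν : Fin d → ℕ} (hν : ∀ j, ∑ i, ν i ≤ ℓ j) (j : Fin d) :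
    (ν j : ℤ) ≤ alpha ℓ ν j := by
  have h : ((ν j + 2 * tailSum ν j : ℕ) : ℤ) ≤ (∑ i ∈ Ioi j.castSucc, ℓ i : ℕ) :=
    Int.ofNat_le.mpr (add_two_mul_tailSum_le hν j)
  push_cast at h
  rw [alpha]
  linarith

theorem poch_sub_alpha_ne_zero {ν : Fin d → ℕ} (hν : ∀ j, ∑ i, ν i ≤ ℓ j) (j : Fin d) :
    poch (-ℓ j.castSucc - alpha ℓ ν j - 1) (2 * ν j) ≠ 0 := by
  have hα := le_alpha hν j
  have hℓ := (single_le_sum_of_canonicallyOrdered (mem_univ j)).trans (hν j.castSucc)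
  have hne := poch_neg_intCast_ne_zero (z := ℓ j.castSucc + alpha ℓ ν j + 1) (k := 2 * ν j)
    (by push_cast; omega)
  push_cast at hne
  convert hne using 2
  ring

theorem generic_natCast_add (ℓ : Fin (d + 1) → ℕ) {ε : ℝ} (hε : Irrational ε) :
    Generic fun i => (ℓ i : ℝ) + ε := fun s hs => by
  rw [sum_add_distrib, sum_const, nsmul_eq_mul, ← Nat.cast_sum]
  exact (hε.natCast_mul hs.card_ne_zero).natCast_add _

@[fun_prop]
theorem continuous_poch (k : ℕ) : Continuous fun a => poch a k :=
  (ascPochhammer ℝ k).continuous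

section ContinuousAt

variable {f g : ℝ → ℝ} {c : ℝ}

theorem continuousAt_hahnCleared (hf : ContinuousAt f c) (hg : ContinuousAt g c) (x M : ℝ)
    (h : poch (-f c) n ≠ 0) : ContinuousAt (fun t => hahnCleared n x (f t) (g t) M) c := by
  unfold hahnCleared
  refine tendsto_finsetSum _ fun k hk => ?_
  have hden : poch (-f c) k * (k.factorial : ℝ) ≠ 0 :=
    mul_ne_zero (poch_ne_zero_of_le h (mem_range_succ_iff.mp hk)) (by positivity)
  exact ContinuousAt.mul (ContinuousAt.div (by fun_prop) (by fun_prop) hden) (by fun_prop)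

theorem continuousAt_hahnWeight (hf : ContinuousAt f c) (hg : ContinuousAt g c)
    (h₁ : poch (-g c) n ≠ 0) (h₂ : poch (n - f c - g c - 1) n ≠ 0) :
    ContinuousAt (fun t => hahnWeight (f t) (g t) n) c :=
  ContinuousAt.div (by fun_prop) (by fun_prop) (mul_ne_zero (mul_ne_zero h₁ h₂) (by positivity))

theorem continuousAt_kernelTerm (hf : ContinuousAt f c) (h : f c ≠ 0) (N M : ℝ) (k : ℕ) :
    ContinuousAt (fun t => kernelTerm (f t) N M n k) c :=
  ContinuousAt.mul
    (ContinuousAt.div (by fun_prop) (by fun_prop) (mul_ne_zero h (by positivity))) (by fun_prop)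

end ContinuousAt

theorem continuousAt_realAlpha (ν : Fin d → ℕ) (j : Fin d) :
    ContinuousAt (fun ε : ℝ => realAlpha (fun i => (ℓ i : ℝ) + ε) ν j) 0 := by
  unfold realAlpha
  fun_prop

theorem continuousAt_realHahnMulti {ν : Fin d → ℕ} (hν : ∀ j, ∑ i, ν i ≤ ℓ j) (N : ℝ)
    (x : Fin d → ℝ) :
    ContinuousAt (fun ε : ℝ => realHahnMulti (fun i => (ℓ i : ℝ) + ε) N ν x) 0 := by
  refine tendsto_finsetProd _ fun j _ =>
    continuousAt_hahnCleared (by fun_prop) (continuousAt_realAlpha ν j) _ _ ?_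
  simp only [add_zero]
  exact poch_neg_natCast_ne_zero ((single_le_sum_of_canonicallyOrdered (mem_univ j)).trans (hν _))

theorem continuousAt_realHahnWeight {ν : Fin d → ℕ} (hν : ∀ j, ∑ i, ν i ≤ ℓ j) :
    ContinuousAt (fun ε : ℝ => realHahnWeight (fun i => (ℓ i : ℝ) + ε) ν) 0 := by
  refine ContinuousAt.mul (by fun_prop) (tendsto_finsetProd _ fun j _ =>
    continuousAt_hahnWeight (by fun_prop) (continuousAt_realAlpha ν j) ?_ ?_)
  · simp only [add_zero, realAlpha_natCast]
    exact poch_neg_intCast_ne_zero (le_alpha hν j)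
  · simp only [add_zero, realAlpha_natCast]
    convert poch_add_natCast_ne_zero (poch_sub_alpha_ne_zero hν j) (two_mul (ν j)).ge using 2
    ring

theorem continuousAt_realElemE {k : ℕ} (hk : ∀ i, k ≤ ℓ i) (X Y : Fin (d + 1) → ℝ) :
    ContinuousAt (fun ε : ℝ => realElemE (fun i => (ℓ i : ℝ) + ε) k X Y) 0 := by
  refine tendsto_finsetSum _ fun γ hγ => tendsto_finsetProd _ fun i _ => ?_
  refine ContinuousAt.div (by fun_prop) (by fun_prop) (mul_ne_zero ?_ (by positivity))
  simp only [add_zero]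
  have hγk : ∑ i, γ i = k := (mem_piAntidiag.mp hγ).1
  have hγi : γ i ≤ ∑ i, γ i := single_le_sum_of_canonicallyOrdered (mem_univ i)
  exact poch_neg_natCast_ne_zero (hγi.trans (hγk.trans_le (hk i)))

theorem realKernel_natCast_eq_sum (hn : ∀ i, n ≤ ℓ i) (X Y : Fin (d + 1) → ℝ) :
    realKernel (fun i => (ℓ i : ℝ)) X Y n =
      ∑ k ∈ range (n + 1), kernelTerm (-∑ i, (ℓ i : ℝ) - 1) (∑ i, X i) (∑ i, Y i) n k *
        realElemE (fun i => (ℓ i : ℝ)) k X Y := by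
  have hleft : ContinuousAt (fun ε : ℝ => realKernel (fun i => (ℓ i : ℝ) + ε) X Y n) 0 := by
    refine tendsto_finsetSum _ fun ν hν => ?_
    have hνℓ (i : Fin (d + 1)) : ∑ i, ν i ≤ ℓ i := (mem_piAntidiag.mp hν).1.trans_le (hn i)
    exact ((continuousAt_realHahnMulti hνℓ _ _).mul (continuousAt_realHahnMulti hνℓ _ _)).mul
      (continuousAt_realHahnWeight hνℓ)
  have hright : ContinuousAt (fun ε : ℝ => ∑ k ∈ range (n + 1),
      kernelTerm (-∑ i, ((ℓ i : ℝ) + ε) - 1) (∑ i, X i) (∑ i, Y i) n k *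
        realElemE (fun i => (ℓ i : ℝ) + ε) k X Y) 0 := by
    refine tendsto_finsetSum _ fun k hk => ContinuousAt.mul
      (continuousAt_kernelTerm (f := fun ε => -∑ i, ((ℓ i : ℝ) + ε) - 1) (by fun_prop) ?_ _ _ k)
      (continuousAt_realElemE (fun i => (mem_range_succ_iff.mp hk).trans (hn i)) X Y)
    rw [← neg_add', neg_ne_zero]
    positivity
  have hfreq := (mem_closure_iff_frequently.mp (dense_irrational 0)).mono fun ε hε =>
    realKernel_eq_sum (generic_natCast_add ℓ hε) X Y n
  simpa only [add_zero] using tendsto_nhds_unique_of_frequently_eq hleft hright hfreq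

variable {N : ℕ}

theorem hahnMulti_eq_realHahnMulti (ℓ : Fin (d + 1) → ℕ) (N : ℕ) (ν : Fin d → ℕ)
    (x : Fin d → ℝ) : hahnMulti ℓ N ν x = realHahnMulti (fun i => (ℓ i : ℝ)) N ν x := by
  simp only [hahnMulti, realHahnMulti, realAlpha_natCast]

theorem init_homog (N : ℕ) (x : Fin d → ℝ) : Fin.init (homog N x) = x :=
  Fin.init_snoc _ _

theorem sum_homog (N : ℕ) (x : Fin d → ℝ) : ∑ i, homog N x i = N := by
  simp [homog, Fin.sum_univ_castSucc]

theorem elemE_eq_realElemE {k : ℕ} (hk : ∀ i, k ≤ ℓ i) (N : ℕ) (x y : Fin d → ℝ) :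
    elemE ℓ N k x y = realElemE (fun i => (ℓ i : ℝ)) k (homog N x) (homog N y) := by
  rw [elemE, realElemE, filter_true_of_mem]
  · simp only [prod_div_distrib, prod_mul_distrib]
  · intro γ hγ i
    have hγk : ∑ i, γ i = k := (mem_piAntidiag.mp hγ).1
    exact (single_le_sum_of_canonicallyOrdered (mem_univ i)).trans (hγk.trans_le (hk i))

theorem hahnWeight_eq_inv {a α : ℝ} {t : ℕ} (h : poch (-a - α - 1) t ≠ 0) :
    hahnWeight a α t =
      (poch (-α) t * poch (-a - α - 1) (2 * t) * t.factorial /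
        (poch (-a) t * poch (-a - α - 1) t))⁻¹ := by
  rw [hahnWeight, two_mul, poch_add, show (t : ℝ) - a - α - 1 = -a - α - 1 + t by ring, inv_div]
  field_simp

theorem inv_hahnNormSq {ν : Fin d → ℕ} (hν : ∀ j, ∑ i, ν i ≤ ℓ j) (N : ℕ) :
    (hahnNormSq ℓ N ν)⁻¹ =
      (-1) ^ (∑ i, ν i) * poch (-(∑ i, ℓ i : ℕ)) N /
          (poch (-N) (∑ i, ν i) * poch (-(∑ i, ℓ i : ℕ)) (N + ∑ i, ν i)) *
        realHahnWeight (fun i => (ℓ i : ℝ)) ν := by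
  have hweight (j : Fin d) := hahnWeight_eq_inv
    (poch_ne_zero_of_le (poch_sub_alpha_ne_zero hν j) (Nat.le_mul_of_pos_left _ two_pos))
  have hsign : ((-1 : ℝ) ^ ∑ i, ν i)⁻¹ = (-1) ^ ∑ i, ν i := by rw [← inv_pow, inv_neg_one]
  simp only [realHahnWeight, realAlpha_natCast, hweight, prod_inv_distrib, ← Nat.cast_sum]
  rw [hahnNormSq, mul_inv, ← mul_assoc, inv_div, mul_assoc ((-1) ^ _), div_mul_eq_div_div_swap,
    div_eq_mul_inv _ ((-1) ^ _), hsign]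
  ring

theorem mem_indexSet_of_sum_le {ν : Fin d → ℕ} (hN : ∑ i, ν i ≤ N) (hν : ∀ j, ∑ i, ν i ≤ ℓ j)
    (hsum : N + ∑ i, ν i ≤ ∑ i, ℓ i) : ν ∈ indexSet ℓ N :=
  ⟨hN, by omega, fun j =>
    ⟨(single_le_sum_of_canonicallyOrdered (mem_univ j)).trans (hν _), le_alpha hν j⟩⟩

theorem add_le_sum_of_le_add (hd : 2 ≤ d) (hadd : ∀ i j, i ≠ j → N ≤ ℓ i + ℓ j)
    (hn : ∀ i, n ≤ ℓ i) : N + n ≤ ∑ i, ℓ i := by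
  obtain ⟨e, rfl⟩ := Nat.exists_eq_add_of_le' hd
  rw [Fin.sum_univ_succ, Fin.sum_univ_succ, Fin.sum_univ_succ]
  have hpair := hadd 0 (Fin.succ 0) (Fin.succ_ne_zero 0).symm
  have hthird := hn (Fin.succ (Fin.succ 0))
  omega

theorem poch_natCast_sub {k : ℕ} (hk : k ≤ n) {a : ℝ} (ha : poch (-a) n ≠ 0) :
    poch (k - a) (n - k) = poch (-a) n / poch (-a) k := by
  rw [eq_div_iff (poch_ne_zero_of_le ha hk), poch_split _ hk, ← sub_eq_neg_add, mul_comm]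

theorem kernelTerm_self_eq {k : ℕ} (hk : k ≤ n) {L M : ℝ} (hL : L + 1 ≠ 0) (hLn : L + 1 - n ≠ 0)
    (hM : poch (-M) n ≠ 0) :
    kernelTerm (-L - 1) M M n k =
      (-1) ^ n * poch (-M) n ^ 2 * poch (-L) n * (L + 1 - 2 * n) / (n.factorial * (L + 1 - n)) *
        (poch (-n) k * poch (n - 1 - L) k / (poch (-M) k * poch (-M) k)) := by
  have hlead : poch (-L - 1) n = (L + 1) * poch (-L) n / (L + 1 - n) := by
    have hshift := poch_succ_left (-L - 1) n
    rw [poch_succ, sub_add_cancel] at hshift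
    rw [eq_div_iff hLn]
    linear_combination -hshift
  have hcoeff := kernelCoeff_add hk (-L - 1) 0
  simp only [zero_add, add_zero] at hcoeff
  have hMk := poch_ne_zero_of_le hM hk
  rw [kernelTerm, hcoeff, kernelCoeff, poch_natCast_sub hk hM, poch_neg_natCast, add_zero,
    Nat.sub_zero, hlead, show -L - 1 + (n : ℝ) = n - 1 - L by ring,
    show -L - 1 = -(L + 1) by ring]
  field_simp
  ring

theorem kernel_eq_realKernel (hnN : n ≤ N) (hn : ∀ i, n ≤ ℓ i) (hsum : N + n ≤ ∑ i, ℓ i)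
    (x y : Fin d → ℝ) :
    kernel ℓ N n x y =
      (-1) ^ n * poch (-(∑ i, ℓ i : ℕ)) N / (poch (-N) n * poch (-(∑ i, ℓ i : ℕ)) (N + n)) *
        realKernel (fun i => (ℓ i : ℝ)) (homog N x) (homog N y) n := by
  classical
  have hmem : ∀ ν ∈ piAntidiag (univ : Finset (Fin d)) n, ν ∈ indexSet ℓ N := fun ν hν => by
    obtain rfl : ∑ i, ν i = n := (mem_piAntidiag.mp hν).1
    exact mem_indexSet_of_sum_le hnN hn hsum
  rw [kernel, filter_true_of_mem hmem, realKernel, mul_sum]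
  refine sum_congr rfl fun ν hν => ?_
  obtain rfl : ∑ i, ν i = n := (mem_piAntidiag.mp hν).1
  rw [div_eq_mul_inv, inv_hahnNormSq hn, hahnMulti_eq_realHahnMulti, hahnMulti_eq_realHahnMulti,
    init_homog, init_homog, sum_homog, sum_homog]
  ring

end HahnPolyhedra

open HahnPolyhedra in
theorem proposition5p3_general (d N : ℕ) (ℓ : Fin (d + 1) → ℕ) (x y : Fin d → ℝ) (n : ℕ)
    (hnN : n ≤ N) (hn : ∀ i, n ≤ ℓ i) (hsum : N + n ≤ ∑ i, ℓ i) :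
    kernel ℓ N n x y =
      poch (-N) n * poch (-(∑ i, ℓ i : ℕ)) N * poch (-(∑ i, ℓ i : ℕ)) n
          * (((∑ i, ℓ i : ℕ) : ℝ) + 1 - 2 * n)
        / ((n.factorial : ℝ) * poch (-(∑ i, ℓ i : ℕ)) (N + n)
          * (((∑ i, ℓ i : ℕ) : ℝ) + 1 - n))
      * ∑ k ∈ Finset.range (n + 1),
          poch (-n) k * poch (n - 1 - (∑ i, ℓ i : ℕ)) k / (poch (-N) k * poch (-N) k)
            * elemE ℓ N k x y := by
  have hN : poch (-N : ℝ) n ≠ 0 := poch_neg_natCast_ne_zero hnN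
  have hL : ((∑ i, ℓ i : ℕ) : ℝ) + 1 ≠ 0 := by positivity
  have hLn : ((∑ i, ℓ i : ℕ) : ℝ) + 1 - n ≠ 0 := by
    have : (n : ℝ) ≤ (∑ i, ℓ i : ℕ) := Nat.cast_le.mpr (by omega)
    linarith
  rw [kernel_eq_realKernel hnN hn hsum, realKernel_natCast_eq_sum hn, sum_homog, sum_homog,
    ← Nat.cast_sum, Finset.mul_sum, Finset.mul_sum]
  refine Finset.sum_congr rfl fun k hk => ?_
  have hkn : k ≤ n := Finset.mem_range_succ_iff.mp hk
  rw [kernelTerm_self_eq hkn hL hLn hN, elemE_eq_realElemE fun i => hkn.trans (hn i)]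
  have hsign : ((-1 : ℝ) ^ n) ^ 2 = 1 := by rw [pow_right_comm, neg_one_sq, one_pow]
  field_simp
  rw [hsign, one_mul]

open HahnPolyhedra in
/-- The hypothesis `hd1` is needed only in one variable, where for `n > ℓ₁ + ℓ₂ - N` the factor
`(-|ℓ|)_{N+n}` in the denominator is zero; for `d ≥ 2` it is nonzero for all `n ≤ ℓ_min`. -/
theorem proposition5p3 (d : ℕ) (hd : 1 ≤ d) (N : ℕ) (ℓ : Fin (d + 1) → ℕ)
    (hle : ∀ i, ℓ i ≤ N) (hadd : ∀ i j, i ≠ j → N ≤ ℓ i + ℓ j)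
    (x y : Fin d → ℕ) (hx : x ∈ polyhedron ℓ N) (hy : y ∈ polyhedron ℓ N)
    (n : ℕ) (hn : n ≤ ellMin ℓ) (hd1 : d = 1 → N + n ≤ ∑ i, ℓ i) :
    kernel ℓ N n (fun i => (x i : ℝ)) (fun i => (y i : ℝ)) =
      poch (-N) n * poch (-(∑ i, ℓ i : ℕ)) N * poch (-(∑ i, ℓ i : ℕ)) n
          * (((∑ i, ℓ i : ℕ) : ℝ) + 1 - 2 * n)
        / ((n.factorial : ℝ) * poch (-(∑ i, ℓ i : ℕ)) (N + n)
          * (((∑ i, ℓ i : ℕ) : ℝ) + 1 - n))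
      * ∑ k ∈ Finset.range (n + 1),
          poch (-n) k * poch (n - 1 - (∑ i, ℓ i : ℕ)) k / (poch (-N) k * poch (-N) k)
            * elemE ℓ N k (fun i => (x i : ℝ)) (fun i => (y i : ℝ)) := by
  have hnℓ (i : Fin (d + 1)) : n ≤ ℓ i := hn.trans (Finset.inf'_le ℓ (Finset.mem_univ i))
  exact proposition5p3_general d N ℓ _ _ n ((hnℓ 0).trans (hle 0)) hnℓ
    (hd.eq_or_lt.elim (fun h => hd1 h.symm) fun h => add_le_sum_of_le_add h hadd hnℓ)
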